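/- Let $X$ be a semilattice (a commutative semigroup of idempotents), ordered by $x\le y \iff xy=x$, and endowed with a Hausdorff topology for which the multiplication $X\times X\to X$ is separately continuous (that is, $X$ is a Hausdorff semitopological semilattice). Suppose that $X$ is complete: every non-empty chain $C\subseteq X$ has an infimum and a supremum in $X$, and both belong to the closure $\overline C$. Suppose moreover that at least one of the following conditions holds: 1. $X$ is a topological semilattice, i.e. the multiplication $X\times X\to X$ is jointly continuous; 2. $X$ is a sequential space, i.e. for each non-closed set $A\subseteq X$ some sequence of points of $A$ converges to a point of $X\setminus A$; 3. $X$ is a $\vec T_{2\delta}$-space, i.e. there is an injective continuous map from $X$ to a $T_{2\delta}$-space $Y$, where $Y$ is called a $T_{2\delta}$-space if it is a $T_1$-space and for every open set $V\subseteq Y$ and every $y\in V$ there is a countable family $\mathcal F$ of closed neighborhoods of $y$ with $\bigcap\mathcal F\subseteq V$; 4. $X$ is functionally Hausdorff, i.e. for any distinct $x,y\in X$ there is a continuous function $f:X\to\mathbb R$ with $f(x)\ne f(y)$. Then every Scott-open subset $U$ of $X$ is open in $X$. Here $U\subseteq X$ is Scott-open if $x\in U$ and $x\le y$ imply $y\in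 U$, and every non-empty up-directed set $D\subseteq X$ that has a supremum $\sup D\in U$ intersects $U$. (A set $D$ is up-directed if any $x,y\in D$ have an upper bound in $D$.) -/

import Mathlib

universe u v

namespace TopSemilattice

/-- A semilattice is a commutative band, with the order `x ≤ y ↔ x * y = x`; this is a
`SemilatticeInf`, the product being `⊓`. It is *semitopological* if the product is separately
continuous. (By commutativity, continuity in one of the two variables suffices.) -/
def IsSemitopological (X : Type*) [SemilatticeInf X] [TopologicalSpace X] : Prop :=
  ∀ a : X, Continuous fun x : X => a ⊓ x

/-- A topologized poset is *complete* if each non-empty chain `C` has an infimum and a supremum,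
and both belong to the closure of `C`. -/
def IsCompletePoset (X : Type*) [PartialOrder X] [TopologicalSpace X] : Prop :=
  ∀ C : Set X, IsChain (· ≤ ·) C → C.Nonempty →
    (∃ a ∈ closure C, IsGLB C a) ∧ (∃ b ∈ closure C, IsLUB C b)

/-- A set is *Scott-open* if it is an upper set that meets each non-empty up-directed set
having a supremum in it. -/
def IsScottOpen {X : Type*} [PartialOrder X] (U : Set X) : Prop :=
  IsUpperSet U ∧
    ∀ D : Set X, D.Nonempty → DirectedOn (· ≤ ·) D →
      ∀ s : X, IsLUB D s → s ∈ U → (D ∩ U).Nonempty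

/-- The Scott-open sets are the open sets of Mathlib's Scott topology. -/
theorem isScottOpen_iff {X : Type*} [PartialOrder X] (U : Set X) :
    IsScottOpen U ↔ @IsOpen X (Topology.scott X Set.univ) U := by
  let : TopologicalSpace X := Topology.scott X Set.univ
  have : Topology.IsScott X Set.univ := ⟨rfl⟩
  refine Iff.trans ?_
    (Topology.IsScott.isOpen_iff_isUpperSet_and_dirSupInaccOn (D := Set.univ)).symm
  constructor
  · rintro ⟨h1, h2⟩
    exact ⟨h1, fun d _ hne hdir a ha haU => h2 d hne hdir a ha haU⟩
  · rintro ⟨h1, h2⟩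
    exact ⟨h1, fun D hne hdir s hs hsU => h2 (Set.mem_univ D) hne hdir hs hsU⟩

open scoped Topology in
/-- A `T_{2δ}`-space: a `T₁`-space in which every open neighborhood of a point `x` contains the
intersection of a countable family of closed neighborhoods of `x`. -/
def IsT2Delta (Y : Type*) [TopologicalSpace Y] : Prop :=
  T1Space Y ∧
    ∀ (U : Set Y) (x : Y), IsOpen U → x ∈ U →
      ∃ F : Set (Set Y), F.Countable ∧ (∀ V ∈ F, IsClosed V ∧ V ∈ 𝓝 x) ∧ ⋂₀ F ⊆ U

/-- A space is `\vec T_{2δ}` if it admits an injective continuous map to a `T_{2δ}`-space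
(in an arbitrary universe). -/
def IsVecT2Delta (X : Type u) [TopologicalSpace X] : Prop :=
  ∃ (Y : Type v) (_ : TopologicalSpace Y), IsT2Delta Y ∧
    ∃ f : X → Y, Continuous f ∧ Function.Injective f

/-- A space is *functionally Hausdorff* if continuous real-valued functions separate points. -/
def IsFunctionallyHausdorff (X : Type*) [TopologicalSpace X] : Prop :=
  ∀ x y : X, x ≠ y → ∃ f : X → ℝ, Continuous f ∧ f x ≠ f y

end TopSemilattice

/-! The complement `F` of `U` is a lower set closed under suprema of chains. If `x ∈ closure F`,
then since `y ↦ x ⊓ y` is continuous and `F` is lower, `⊤` lies in the closure of the trace of `F`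
on `Iic x`. So it is enough to show that `⊤ ∈ closure F` forces `⊤ ∈ F`.

The tool is a lower limit (`liminf_mem`). Given points of `F` whose finite infima over each tail
stay in `O j`, the tail infima exist, lie in `F` and increase, so their supremum is a point of `F`
in every `closure (O j)`. Such points are chosen recursively: by separate continuity, `a ⊓ y` tends
to `a` as `y` tends to `⊤`. This handles countably many neighborhoods of `⊤`. Each hypothesis then
supplies a way to reach enough neighborhoods to isolate `⊤`: a minimal closed subsemilattice (joint
continuity), a filter with maximal lower limit (sequentiality), or induction on the cardinality of a
family of regular `Gδ`-sets (the last two conditions). -/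

namespace TopSemilattice

open Set Filter Topology

/-! ### Infima and suprema in complete semilattices -/

section Basic

variable {X : Type*} [SemilatticeInf X] [TopologicalSpace X]

theorem IsSemitopological.isClosed_Iic [T2Space X] (hX : IsSemitopological X) (a : X) :
    IsClosed (Iic a) := by
  have h : Iic a = {x | a ⊓ x = x} := by ext x; simp
  rw [h]
  exact isClosed_eq (hX a) continuous_id

theorem IsSemitopological.isClosed_Ici [T2Space X] (hX : IsSemitopological X) (a : X) :
    IsClosed (Ici a) := by
  have h : Ici a = {x | a ⊓ x = a} := by ext x; simp
  rw [h]
  exact isClosed_eq (hX a) continuous_const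

theorem IsSemitopological.infClosed_closure (hX : IsSemitopological X) {A : Set X}
    (hA : InfClosed A) : InfClosed (closure A) := by
  have h1 : ∀ a ∈ A, ∀ b ∈ closure A, a ⊓ b ∈ closure A := fun a ha b hb =>
    map_mem_closure (hX a) hb fun c hc => hA ha hc
  intro a ha b hb
  have h2 : b ⊓ a ∈ closure (closure A) := map_mem_closure (hX b) ha fun c hc => by
    simpa only [inf_comm] using h1 c hc b hb
  rwa [closure_closure, inf_comm] at h2

/-- In a complete semitopological semilattice each non-empty subsemilattice has an infimum, lying
in its closure. -/
theorem IsCompletePoset.exists_isGLB_of_infClosed [T2Space X] (hX : IsSemitopological X)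
    (hc : IsCompletePoset X) {A : Set X} (hA : InfClosed A) (hne : A.Nonempty) :
    ∃ m ∈ closure A, IsGLB A m := by
  -- The closure is again closed under `⊓`, so a minimal element of it is its least element.
  obtain ⟨m, hm⟩ : ∃ m : X, Minimal (· ∈ closure A) m := by
    refine zorn_le₀ (α := Xᵒᵈ) (closure A) fun C hCA hC => ?_
    rcases C.eq_empty_or_nonempty with rfl | hCne
    · obtain ⟨a, ha⟩ := hne
      exact ⟨a, subset_closure ha, by simp⟩
    · obtain ⟨⟨a, ha, hglb⟩, -⟩ := hc C hC.symm hCne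
      exact ⟨a, closure_minimal hCA isClosed_closure ha, fun z hz => hglb.1 hz⟩
  have hle : ∀ a ∈ closure A, m ≤ a := fun a ha =>
    (hm.2 (hX.infClosed_closure hA hm.1 ha) inf_le_left).trans inf_le_right
  refine ⟨m, hm.1, fun a ha => hle a (subset_closure ha), fun l hl => ?_⟩
  exact closure_minimal (show A ⊆ Ici l from hl) (hX.isClosed_Ici l) hm.1

theorem IsCompletePoset.exists_isGLB [OrderTop X] [T2Space X] (hX : IsSemitopological X)
    (hc : IsCompletePoset X) (A : Set X) : ∃ m, IsGLB A m := by
  classical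
  obtain ⟨m, -, hm⟩ := hc.exists_isGLB_of_infClosed hX
    (A := {y | ∃ s : Finset X, ↑s ⊆ A ∧ s.inf id = y})
    (by
      rintro _ ⟨s, hs, rfl⟩ _ ⟨t, ht, rfl⟩
      exact ⟨s ∪ t, by simp [hs, ht], Finset.inf_union⟩)
    ⟨⊤, ∅, by simp⟩
  refine ⟨m, fun a ha => hm.1 ⟨{a}, by simpa using ha, by simp⟩, fun l hl => hm.2 ?_⟩
  rintro _ ⟨s, hs, rfl⟩
  exact Finset.le_inf fun a ha => hl (hs ha)

theorem IsCompletePoset.exists_isLUB [OrderTop X] [T2Space X] (hX : IsSemitopological X)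
    (hc : IsCompletePoset X) (A : Set X) : ∃ m, IsLUB A m := by
  obtain ⟨m, hm⟩ := hc.exists_isGLB hX (upperBounds A)
  exact ⟨m, isGLB_upperBounds.1 hm⟩

end Basic

/-- The supremum of a chain belongs to the closure of each tail of the chain. -/
theorem IsCompletePoset.mem_closure_tail {X : Type*} [PartialOrder X] [TopologicalSpace X]
    (hc : IsCompletePoset X) {C : Set X} (hC : IsChain (· ≤ ·) C) {b : X} (hb : IsLUB C b)
    {c : X} (hcC : c ∈ C) : b ∈ closure {y ∈ C | c ≤ y} := by
  obtain ⟨-, b', hb', hlub⟩ := hc {y ∈ C | c ≤ y} (hC.mono fun y hy => hy.1) ⟨c, hcC, le_rfl⟩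
  have hcb : c ≤ b' := hlub.1 ⟨hcC, le_rfl⟩
  have : IsLUB C b' := by
    refine ⟨fun y hy => ?_, fun z hz => hlub.2 fun y hy => hz hy.1⟩
    rcases hC.total hcC hy with h | h
    · exact hlub.1 ⟨hy, h⟩
    · exact h.trans hcb
  rwa [hb.unique this]

/-- A lower set containing the suprema of its non-empty chains. -/
structure IsChainClosedLower {X : Type*} [PartialOrder X] (F : Set X) : Prop where
  lower : IsLowerSet F
  sup_mem : ∀ C ⊆ F, IsChain (· ≤ ·) C → C.Nonempty → ∀ b, IsLUB C b → b ∈ F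

/-! ### Lower limits and recursive choice -/

section Liminf

variable {X : Type*} [SemilatticeInf X] [OrderTop X] [TopologicalSpace X] [T2Space X]
  {ι : Type*} [LinearOrder ι]

/-- The lower limit of a family whose finite infima stay in given sets. -/
theorem IsCompletePoset.liminf_mem [Nonempty ι] (hX : IsSemitopological X)
    (hc : IsCompletePoset X) {F : Set X} (hF : IsChainClosedLower F) {x : ι → X}
    (hxF : ∀ i, x i ∈ F) {O : ι → Set X}
    (hO : ∀ s : Finset ι, s.Nonempty → ∀ j, (∀ i ∈ s, j ≤ i) → s.inf x ∈ O j) {d : X}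
    (hd : IsLUB {a | ∃ j, ∀ i, j ≤ i → a ≤ x i} d) :
    d ∈ F ∧ ∀ j, d ∈ closure (O j) := by
  classical
  have key : ∀ j, ∃ m, (∀ k ≤ j, m ∈ closure (O k)) ∧ IsGLB (x '' Ici j) m := by
    intro j
    obtain ⟨m, hmem, hm⟩ := hc.exists_isGLB_of_infClosed hX
      (A := {y | ∃ s : Finset ι, s.Nonempty ∧ (∀ i ∈ s, j ≤ i) ∧ s.inf x = y})
      (by
        rintro _ ⟨s, hs, hs', rfl⟩ _ ⟨t, ht, ht', rfl⟩
        refine ⟨s ∪ t, hs.mono Finset.subset_union_left, fun i hi => ?_, Finset.inf_union⟩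
        rcases Finset.mem_union.1 hi with h | h
        exacts [hs' i h, ht' i h])
      ⟨x j, {j}, by simp⟩
    refine ⟨m, fun k hk => closure_mono ?_ hmem, ?_, fun l hl => hm.2 ?_⟩
    · rintro _ ⟨s, hs, hs', rfl⟩
      exact hO s hs k fun i hi => hk.trans (hs' i hi)
    · rintro _ ⟨i, hi, rfl⟩
      exact hm.1 ⟨{i}, by simpa using hi⟩
    · rintro _ ⟨s, hs, hs', rfl⟩
      exact Finset.le_inf fun i hi => hl ⟨i, hs' i hi, rfl⟩
  choose m hmO hm using key
  have hmono : Monotone m := fun j k hjk => (hm k).2 fun _ hy =>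
    (hm j).1 (image_mono (Ici_subset_Ici.2 hjk) hy)
  have hlub : IsLUB (range m) d := by
    refine ⟨?_, fun b hb => hd.2 ?_⟩
    · rintro _ ⟨j, rfl⟩
      exact hd.1 ⟨j, fun i hi => (hm j).1 ⟨i, hi, rfl⟩⟩
    · rintro a ⟨j, hj⟩
      refine le_trans ((hm j).2 ?_) (hb ⟨j, rfl⟩)
      rintro _ ⟨i, hi, rfl⟩
      exact hj i hi
  have hchain : IsChain (· ≤ ·) (range m) := hmono.isChain_range
  refine ⟨hF.sup_mem _ ?_ hchain (range_nonempty m) d hlub, fun j => ?_⟩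
  · rintro _ ⟨j, rfl⟩
    exact hF.lower ((hm j).1 ⟨j, le_rfl, rfl⟩) (hxF j)
  -- Only the part of the chain above `m j` matters. If an element of it has index below `j`,
  -- monotonicity makes it equal to `m j`.
  · refine closure_minimal ?_ isClosed_closure (hc.mem_closure_tail hchain hlub ⟨j, rfl⟩)
    rintro _ ⟨⟨k, rfl⟩, hk⟩
    rcases le_total j k with h | h
    · exact hmO k j h
    · rw [le_antisymm (hmono h) hk]
      exact hmO j j le_rfl

end Liminf

/-- Recursive choice of a family whose finite infima stay in given sets. -/
theorem exists_finset_inf_mem {X : Type*} [SemilatticeInf X] [OrderTop X] {ι : Type*}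
    [LinearOrder ι] [WellFoundedLT ι] {T O : ι → Set X} (hO : ∀ j, ⊤ ∈ O j)
    (h : ∀ (j : ι) (f : ι → X), ∃ y ∈ T j, ∀ s : Finset ι, (∀ i ∈ s, i < j) →
      ∀ k ≤ j, s.inf f ∈ O k → s.inf f ⊓ y ∈ O k) :
    ∃ x : ι → X, (∀ j, x j ∈ T j) ∧
      ∀ s : Finset ι, s.Nonempty → ∀ j, (∀ i ∈ s, j ≤ i) → s.inf x ∈ O j := by
  classical
  choose g hgT hg using h
  let x : ι → X := WellFoundedLT.fix (motive := fun _ => X) fun j ih =>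
    g j fun i => if hij : i < j then ih i hij else ⊤
  have hx : ∀ j, x j = g j fun i => if i < j then x i else ⊤ := by
    intro j
    simp only [x]
    rw [WellFoundedLT.fix_eq]
    simp only [dite_eq_ite]
  refine ⟨x, fun j => by rw [hx]; exact hgT _ _, fun s hs j => ?_⟩
  -- The empty infimum is `⊤ ∈ O j`, so the induction may start from the empty set.
  clear hs
  induction s using Finset.induction_on_max with
  | empty => simp [hO]
  | insert a s hs ih =>
    intro hj
    have h1 : s.inf x = s.inf fun i => if i < a then x i else ⊤ :=
      Finset.inf_congr rfl fun i hi => by simp [hs i hi]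
    have h2 := ih fun i hi => hj i (Finset.mem_insert_of_mem hi)
    rw [Finset.inf_insert, inf_comm, h1, hx a]
    rw [h1] at h2
    exact hg a _ s hs j (hj a (Finset.mem_insert_self a s)) h2

/-! ### Countably many neighborhoods of the top element -/

section Countable

variable {X : Type*} [SemilatticeInf X] [OrderTop X] [TopologicalSpace X]

/-- Choice of a sequence along a filter converging to `⊤`, with finite infima in given open sets. -/
theorem exists_seq_finset_inf_mem (hX : IsSemitopological X) {l : Filter X} [l.NeBot]
    (hl : l ≤ 𝓝 ⊤) {T : ℕ → Set X} (hT : ∀ n, T n ∈ l) {O : ℕ → Set X}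
    (hO : ∀ n, IsOpen (O n)) (hOtop : ∀ n, ⊤ ∈ O n) :
    ∃ x : ℕ → X, (∀ n, x n ∈ T n) ∧
      ∀ s : Finset ℕ, s.Nonempty → ∀ n, (∀ i ∈ s, n ≤ i) → s.inf x ∈ O n := by
  refine exists_finset_inf_mem hOtop fun n f => ?_
  have h1 : ∀ᶠ y in l, ∀ s ∈ (Finset.range n).powerset, ∀ k ∈ Finset.range (n + 1),
      s.inf f ∈ O k → s.inf f ⊓ y ∈ O k := by
    rw [Finset.eventually_all]
    intro s _
    rw [Finset.eventually_all]
    intro k _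
    by_cases hk : s.inf f ∈ O k
    · have h2 : Tendsto (fun y => s.inf f ⊓ y) l (𝓝 (s.inf f)) := by
        have := ((hX (s.inf f)).tendsto ⊤).mono_left hl
        rwa [inf_top_eq] at this
      filter_upwards [h2.eventually ((hO k).mem_nhds hk)] with y hy _ using hy
    · exact .of_forall fun y h => absurd h hk
  obtain ⟨y, hyT, hy⟩ := (Filter.Eventually.and (hT n) h1).exists
  refine ⟨y, hyT, fun s hs k hk => hy s ?_ k ?_⟩
  · exact Finset.mem_powerset.2 fun i hi => Finset.mem_range.2 (hs i hi)
  · exact Finset.mem_range.2 (Nat.lt_succ_of_le hk)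

theorem IsCompletePoset.exists_mem_closure_of_countable [T2Space X] (hX : IsSemitopological X)
    (hc : IsCompletePoset X) {F : Set X} (hF : IsChainClosedLower F) (htop : ⊤ ∈ closure F)
    {𝒪 : Set (Set X)} (h𝒪 : 𝒪.Countable) (hopen : ∀ O ∈ 𝒪, IsOpen O ∧ ⊤ ∈ O) :
    ∃ d ∈ F, ∀ O ∈ 𝒪, d ∈ closure O := by
  obtain ⟨O, hO⟩ := (h𝒪.insert univ).exists_eq_range (insert_nonempty _ _)
  have hO' : ∀ n, IsOpen (O n) ∧ ⊤ ∈ O n := by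
    intro n
    rcases hO.symm.subset ⟨n, rfl⟩ with h | h
    · rw [h]; simp
    · exact hopen _ h
  have : (𝓝[F] (⊤ : X)).NeBot := mem_closure_iff_nhdsWithin_neBot.1 htop
  obtain ⟨x, hxF, hx⟩ := exists_seq_finset_inf_mem hX (l := 𝓝[F] ⊤) nhdsWithin_le_nhds
    (T := fun _ => F) (fun _ => self_mem_nhdsWithin) (fun n => (hO' n).1) fun n => (hO' n).2
  obtain ⟨d, hd⟩ := hc.exists_isLUB hX {a | ∃ j, ∀ i, j ≤ i → a ≤ x i}
  obtain ⟨hdF, hdO⟩ := hc.liminf_mem hX hF hxF hx hd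
  refine ⟨d, hdF, fun V hV => ?_⟩
  obtain ⟨n, rfl⟩ := hO.subset (mem_insert_of_mem _ hV)
  exact hdO n

end Countable

end TopSemilattice

namespace TopSemilattice

open Set Filter Topology

/-! ### Jointly continuous multiplication -/

section Topological

variable {X : Type*} [SemilatticeInf X] [OrderTop X] [TopologicalSpace X]

/-- A sequence of open neighborhoods of `⊤`, each containing the square of the next one. -/
structure IsNhdsTower (W : ℕ → Set X) : Prop where
  isOpen : ∀ n, IsOpen (W n)
  top_mem : ∀ n, ⊤ ∈ W n
  inf_mem : ∀ n, ∀ a ∈ W (n + 1), ∀ b ∈ W (n + 1), a ⊓ b ∈ W n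

theorem IsNhdsTower.inter {W W' : ℕ → Set X} (h : IsNhdsTower W) (h' : IsNhdsTower W') :
    IsNhdsTower fun n => W n ∩ W' n where
  isOpen n := (h.isOpen n).inter (h'.isOpen n)
  top_mem n := ⟨h.top_mem n, h'.top_mem n⟩
  inf_mem n a ha b hb := ⟨h.inf_mem n a ha.1 b hb.1, h'.inf_mem n a ha.2 b hb.2⟩

theorem IsNhdsTower.infClosed [ContinuousInf X] {W : ℕ → Set X} (h : IsNhdsTower W) :
    InfClosed (⋂ n, closure (W n)) := by
  intro a ha b hb
  simp only [mem_iInter] at ha hb ⊢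
  exact fun n => map_mem_closure₂ continuous_inf (ha (n + 1)) (hb (n + 1)) (h.inf_mem n)

theorem exists_isNhdsTower [ContinuousInf X] {N : Set X} (hN : IsOpen N) (htop : ⊤ ∈ N) :
    ∃ W, IsNhdsTower W ∧ W 0 = N := by
  have step : ∀ N : {N : Set X // IsOpen N ∧ ⊤ ∈ N}, ∃ N' : {N : Set X // IsOpen N ∧ ⊤ ∈ N},
      ∀ a ∈ N'.1, ∀ b ∈ N'.1, a ⊓ b ∈ N.1 := by
    rintro ⟨N, hN, htop⟩
    have h : (fun p : X × X => p.1 ⊓ p.2) ⁻¹' N ∈ 𝓝 ((⊤ : X), (⊤ : X)) :=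
      (hN.preimage continuous_inf).mem_nhds (by simpa using htop)
    obtain ⟨A, B, hA, hAt, hB, hBt, hAB⟩ := mem_nhds_prod_iff'.1 h
    exact ⟨⟨A ∩ B, hA.inter hB, hAt, hBt⟩, fun a ha b hb =>
      @hAB (a, b) ⟨ha.1, hb.2⟩⟩
  choose g hg using step
  exact ⟨fun n => (g^[n] ⟨N, hN, htop⟩).1,
    ⟨fun n => (g^[n] ⟨N, hN, htop⟩).2.1, fun n => (g^[n] ⟨N, hN, htop⟩).2.2, fun n => by
      rw [Function.iterate_succ_apply']
      exact hg _⟩, rfl⟩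

/-- Take a minimal closed subsemilattice `T` such that `F ∩ T` meets `S W` for every tower `W`.
Towers can be intersected, so `T ∩ S W` has the same property and minimality gives `T ⊆ S W`. Hence
a point of `F ∩ T` lies in the closure of every open neighborhood of `⊤`, and must be `⊤`. -/
theorem IsCompletePoset.top_mem_of_continuousInf [T2Space X] [ContinuousInf X]
    (hX : IsSemitopological X) (hc : IsCompletePoset X) {F : Set X} (hF : IsChainClosedLower F)
    (htop : ⊤ ∈ closure F) : ⊤ ∈ F := by
  let S : (ℕ → Set X) → Set X := fun W => ⋂ n, closure (W n)
  have hS : ∀ W, IsClosed (S W) := fun W => isClosed_iInter fun n => isClosed_closure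
  have hSinter : ∀ W W', S (fun n => W n ∩ W' n) ⊆ S W ∩ S W' := fun W W' => subset_inter
    (iInter_mono fun n => closure_mono inter_subset_left)
    (iInter_mono fun n => closure_mono inter_subset_right)
  obtain ⟨T, ⟨hTcl, hTinf, hT⟩, hmin⟩ : ∃ T : Set X, Minimal (· ∈ {T : Set X | IsClosed T ∧
      InfClosed T ∧ ∀ W, IsNhdsTower W → ∃ d ∈ F, d ∈ T ∩ S W}) T := by
    refine zorn_superset _ fun c hc' hchain => ?_
    refine ⟨⋂₀ c, ⟨isClosed_sInter fun T hT => (hc' hT).1,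
      fun a ha b hb T hT => (hc' hT).2.1 (ha T hT) (hb T hT), fun W hW => ?_⟩,
      fun T hT => sInter_subset_of_mem hT⟩
    rcases c.eq_empty_or_nonempty with rfl | hcne
    · obtain ⟨d, hd, hdW⟩ := hc.exists_mem_closure_of_countable hX hF htop
        (countable_range W) (by rintro _ ⟨n, rfl⟩; exact ⟨hW.isOpen n, hW.top_mem n⟩)
      exact ⟨d, hd, by simp, mem_iInter.2 fun n => hdW _ ⟨n, rfl⟩⟩
    -- The least elements grow as `T` shrinks, so they form a chain; its supremum stays in `F` and
    -- in every `T ∩ S W`.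
    · have hleast : ∀ T : c, ∃ e, IsLeast (F ∩ (T.1 ∩ S W)) e := by
        rintro ⟨T, hTc⟩
        obtain ⟨d, hd⟩ := (hc' hTc).2.2 W hW
        obtain ⟨e, he, hglb⟩ := hc.exists_isGLB_of_infClosed hX (A := F ∩ (T ∩ S W))
          (fun a ha b hb => ⟨hF.lower inf_le_left ha.1, (hc' hTc).2.1 ha.2.1 hb.2.1,
            hW.infClosed ha.2.2 hb.2.2⟩) ⟨d, hd⟩
        exact ⟨e, ⟨hF.lower (hglb.1 hd) hd.1, closure_minimal inter_subset_right
          ((hc' hTc).1.inter (hS W)) he⟩, hglb.1⟩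
      choose e he using hleast
      have hanti : ∀ T T' : c, T.1 ⊆ T'.1 → e T' ≤ e T := fun T T' h =>
        (he T').2 ⟨(he T).1.1, h (he T).1.2.1, (he T).1.2.2⟩
      have hch : IsChain (· ≤ ·) (range e) := by
        rintro _ ⟨T, rfl⟩ _ ⟨T', rfl⟩ -
        exact (hchain.total T.2 T'.2).symm.imp (hanti _ _) (hanti _ _)
      have : Nonempty c := hcne.to_subtype
      obtain ⟨-, b, -, hb⟩ := hc _ hch (range_nonempty e)
      have hbT : ∀ T : c, b ∈ T.1 ∩ S W := by
        intro T
        refine closure_minimal ?_ ((hc' T.2).1.inter (hS W))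
          (hc.mem_closure_tail hch hb ⟨T, rfl⟩)
        rintro _ ⟨⟨T', rfl⟩, hle⟩
        rcases hchain.total T.2 T'.2 with h | h
        · rw [← le_antisymm hle (hanti _ _ h)]
          exact (he T).1.2
        · exact ⟨h (he T').1.2.1, (he T').1.2.2⟩
      refine ⟨b, hF.sup_mem _ ?_ hch (range_nonempty e) b hb,
        fun T hT => (hbT ⟨T, hT⟩).1, (hbT (Classical.arbitrary c)).2⟩
      rintro _ ⟨T, rfl⟩
      exact (he T).1.1
  have hTS : ∀ W, IsNhdsTower W → T ⊆ S W := by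
    intro W hW
    refine fun t ht => (hmin (y := T ∩ S W) ⟨hTcl.inter (hS W),
      fun a ha b hb => ⟨hTinf ha.1 hb.1, hW.infClosed ha.2 hb.2⟩, fun W' hW' => ?_⟩
      inter_subset_left ht).2
    obtain ⟨d, hd, hdT, hdS⟩ := hT _ (hW.inter hW')
    exact ⟨d, hd, ⟨hdT, (hSinter _ _ hdS).1⟩, (hSinter _ _ hdS).2⟩
  obtain ⟨d, hd, hdT, -⟩ := hT (fun _ => univ) ⟨by simp, by simp, by simp⟩
  by_contra hF'
  have hne : (⊤ : X) ≠ d := fun h => hF' (h ▸ hd)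
  obtain ⟨N, N', hN, hN', htN, hdN', hdisj⟩ := t2_separation hne
  obtain ⟨W, hW, rfl⟩ := exists_isNhdsTower hN htN
  exact (hdisj.closure_left hN').le_bot ⟨mem_iInter.1 (hTS W hW hdT) 0, hdN'⟩

end Topological

/-! ### Separation by regular `Gδ`-sets -/

section RegularGδ

/-- A set is a *regular `Gδ`-set* if it is the intersection of countably many open sets, and also
the intersection of their closures. -/
def IsRegularGδ {X : Type*} [TopologicalSpace X] (S : Set X) : Prop :=
  ∃ 𝒪 : Set (Set X), 𝒪.Countable ∧ (∀ O ∈ 𝒪, IsOpen O) ∧ (∀ O ∈ 𝒪, S ⊆ O) ∧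
    ∀ x, (∀ O ∈ 𝒪, x ∈ closure O) → x ∈ S

theorem IsRegularGδ.isClosed {X : Type*} [TopologicalSpace X] {S : Set X} (h : IsRegularGδ S) :
    IsClosed S := by
  obtain ⟨𝒪, -, -, hS, hS'⟩ := h
  have : S = ⋂ O ∈ 𝒪, closure O := Subset.antisymm
    (subset_iInter₂ fun O hO => (hS O hO).trans subset_closure)
    fun x hx => hS' x (by simpa using hx)
  rw [this]
  exact isClosed_biInter fun O _ => isClosed_closure

theorem IsRegularGδ.preimage {X Y : Type*} [TopologicalSpace X] [TopologicalSpace Y] {S : Set Y}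
    (h : IsRegularGδ S) {f : X → Y} (hf : Continuous f) : IsRegularGδ (f ⁻¹' S) := by
  obtain ⟨𝒪, hcount, hopen, hS, hS'⟩ := h
  refine ⟨(f ⁻¹' ·) '' 𝒪, hcount.image _, ?_, ?_, fun x hx => hS' _ fun O hO => ?_⟩
  · rintro _ ⟨O, hO, rfl⟩
    exact (hopen O hO).preimage hf
  · rintro _ ⟨O, hO, rfl⟩
    exact preimage_mono (hS O hO)
  · exact hf.closure_preimage_subset O (hx _ ⟨O, hO, rfl⟩)

/-- Starting from `U`, iterate the choice of countably many closed neighborhoods whose intersection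
lies in the interior of the given one. The countable family obtained has the same intersection as
the family of its interiors. -/
theorem IsT2Delta.exists_isRegularGδ {Y : Type*} [TopologicalSpace Y] (hY : IsT2Delta Y)
    {U : Set Y} (hU : IsOpen U) {y : Y} (hy : y ∈ U) :
    ∃ S, IsRegularGδ S ∧ y ∈ S ∧ S ⊆ U := by
  have key : ∀ A : {A : Set Y // A ∈ 𝓝 y}, ∃ G : Set {A : Set Y // A ∈ 𝓝 y}, G.Countable ∧
      (∀ B ∈ G, IsClosed B.1) ∧ ∀ z, (∀ B ∈ G, z ∈ B.1) → z ∈ interior A.1 := by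
    rintro ⟨A, hA⟩
    obtain ⟨F, hF, hF', hFA⟩ := hY.2 (interior A) y isOpen_interior (mem_interior_iff_mem_nhds.2 hA)
    refine ⟨Subtype.val ⁻¹' F, hF.preimage Subtype.val_injective, fun B hB => (hF' _ hB).1,
      fun z hz => hFA fun B hB => hz ⟨B, (hF' B hB).2⟩ hB⟩
  choose G hGc hGcl hG using key
  let U' : {A : Set Y // A ∈ 𝓝 y} := ⟨U, hU.mem_nhds hy⟩
  let 𝒜 : ℕ → Set {A : Set Y // A ∈ 𝓝 y} := fun n =>
    Nat.rec (G U') (fun _ 𝒜 => ⋃ A ∈ 𝒜, G A) n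
  have hcount : ∀ n, (𝒜 n).Countable := by
    intro n
    induction n with
    | zero => exact hGc _
    | succ n ih => exact ih.biUnion fun A _ => hGc A
  have hcl : ∀ n, ∀ A ∈ 𝒜 n, IsClosed A.1 := by
    intro n
    cases n with
    | zero => exact hGcl U'
    | succ n =>
      intro A hA
      obtain ⟨B, -, hB⟩ := mem_iUnion₂.1 hA
      exact hGcl B A hB
  refine ⟨{z | ∀ n, ∀ A ∈ 𝒜 n, z ∈ A.1}, ?_, fun n A _ => mem_of_mem_nhds A.2, fun z hz =>
    interior_subset (hG U' z fun B hB => hz 0 B hB)⟩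
  refine ⟨(fun A => interior A.1) '' ⋃ n, 𝒜 n, (countable_iUnion hcount).image _, ?_, ?_, ?_⟩
  · rintro _ ⟨A, -, rfl⟩
    exact isOpen_interior
  · rintro _ ⟨A, hA, rfl⟩ z hz
    obtain ⟨n, hn⟩ := mem_iUnion.1 hA
    exact hG A z fun B hB => hz (n + 1) B (mem_iUnion₂.2 ⟨A, hn, hB⟩)
  · intro z hz n A hA
    exact closure_minimal interior_subset (hcl n A hA)
      (hz _ ⟨A, mem_iUnion.2 ⟨n, hA⟩, rfl⟩)

theorem isT2Delta_of_regular (Y : Type*) [TopologicalSpace Y] [T3Space Y] : IsT2Delta Y := by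
  refine ⟨inferInstance, fun U y hU hy => ?_⟩
  obtain ⟨V, hV, hVcl, hVU⟩ := exists_mem_nhds_isClosed_subset (hU.mem_nhds hy)
  exact ⟨{V}, countable_singleton V, by simp [hV, hVcl], by simpa using hVU⟩

theorem IsVecT2Delta.exists_isRegularGδ {X : Type u} [TopologicalSpace X]
    (hX : IsVecT2Delta.{u, v} X) {x y : X} (hxy : x ≠ y) :
    ∃ S, IsRegularGδ S ∧ x ∈ S ∧ y ∉ S := by
  obtain ⟨Y, _, hY, f, hf, hinj⟩ := hX
  have := hY.1
  obtain ⟨S, hS, hxS, hSy⟩ := hY.exists_isRegularGδ (isOpen_compl_singleton (x := f y))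
    (y := f x) (fun h => hxy (hinj h))
  exact ⟨f ⁻¹' S, hS.preimage hf, hxS, fun h => hSy h rfl⟩

theorem IsFunctionallyHausdorff.exists_isRegularGδ {X : Type*} [TopologicalSpace X]
    (hX : IsFunctionallyHausdorff X) {x y : X} (hxy : x ≠ y) :
    ∃ S, IsRegularGδ S ∧ x ∈ S ∧ y ∉ S := by
  obtain ⟨f, hf, hne⟩ := hX x y hxy
  obtain ⟨S, hS, hxS, hSy⟩ := (isT2Delta_of_regular ℝ).exists_isRegularGδ
    (isOpen_compl_singleton (x := f y)) (y := f x) hne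
  exact ⟨f ⁻¹' S, hS.preimage hf, hxS, fun h => hSy h rfl⟩

variable {X : Type u} [SemilatticeInf X] [OrderTop X] [TopologicalSpace X] [T2Space X]

open Cardinal in
theorem mk_prod_finset_Iio_lt {ι : Type u} [LinearOrder ι] {κ : Cardinal.{u}} (hκ : ℵ₀ < κ)
    {i : ι} (hi : #(Iio i) < κ) : #(Iic i × Finset (Iio i)) < κ := by
  have hle : #(Iic i) ≤ #(Iio i) + 1 := by
    rw [← Iio_insert]
    exact mk_insert_le
  rw [mk_prod, lift_id, lift_id]
  refine mul_lt_of_lt hκ.le (hle.trans_lt (add_lt_of_lt hκ.le hi (one_lt_aleph0.trans hκ))) ?_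
  cases finite_or_infinite (Iio i)
  · exact (lt_aleph0_of_finite _).trans hκ
  · rwa [mk_finset_of_infinite]

-- Transfinite induction on the size of `𝒱`. For uncountable `κ`, enumerate `𝒱` along the initial
-- ordinal of `κ`. The choice at stage `j` must respect fewer than `κ` conditions, each the preimage
-- of some `V` under a translation, hence again a regular `Gδ`-set; the induction hypothesis
-- provides the point.
open Cardinal in
theorem IsCompletePoset.exists_mem_of_isRegularGδ (hX : IsSemitopological X)
    (hc : IsCompletePoset X) {F : Set X} (hF : IsChainClosedLower F) (htop : ⊤ ∈ closure F)
    (κ : Cardinal.{u}) (𝒱 : Set (Set X)) (hκ : #𝒱 = κ)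
    (h𝒱 : ∀ V ∈ 𝒱, IsRegularGδ V ∧ ⊤ ∈ V) : ∃ d ∈ F, ∀ V ∈ 𝒱, d ∈ V := by
  induction κ using WellFoundedLT.induction generalizing 𝒱 with
  | ind κ ih =>
  rcases le_or_gt κ ℵ₀ with hle | hlt
  · have hcount : 𝒱.Countable := by rwa [← le_aleph0_iff_set_countable, hκ]
    choose! 𝒪 h𝒪 hopen hsub hmem using fun V hV => (h𝒱 V hV).1
    obtain ⟨d, hd, hd'⟩ := hc.exists_mem_closure_of_countable hX hF htop
      (hcount.biUnion h𝒪) (by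
        intro O hO
        obtain ⟨V, hV, hOV⟩ := mem_iUnion₂.1 hO
        exact ⟨hopen V hV O hOV, hsub V hV O hOV (h𝒱 V hV).2⟩)
    exact ⟨d, hd, fun V hV => hmem V hV d fun O hO => hd' O (mem_iUnion₂.2 ⟨V, hV, hO⟩)⟩
  · obtain ⟨e⟩ : Nonempty (κ.ord.ToType ≃ 𝒱) := by rw [← Cardinal.eq, hκ, mk_ord_toType]
    have : Nonempty κ.ord.ToType := by
      rw [← mk_ne_zero_iff, mk_ord_toType]
      exact (aleph0_pos.trans hlt).ne'
    have step : ∀ (j : κ.ord.ToType) (f : κ.ord.ToType → X), ∃ y ∈ F,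
        ∀ s : Finset κ.ord.ToType, (∀ i ∈ s, i < j) →
          ∀ k ≤ j, s.inf f ∈ (e k).1 → s.inf f ⊓ y ∈ (e k).1 := by
      intro j f
      let g : Iic j × Finset (Iio j) → Set X := fun p =>
        {y | (p.2.inf fun i => f i) ⊓ y ∈ (e p.1).1}
      -- Membership of `⊤` in such a preimage says exactly that the earlier infimum already lies in
      -- `e k`.
      have hcard : #{V ∈ range g | ⊤ ∈ V} < κ :=
        (mk_le_mk_of_subset (sep_subset _ _)).trans_lt <| mk_range_le.trans_lt <|
          mk_prod_finset_Iio_lt hlt (by simpa using mk_Iio_lt j (by simp))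
      obtain ⟨y, hyF, hy⟩ := ih _ hcard {V ∈ range g | ⊤ ∈ V} rfl (by
        rintro _ ⟨⟨p, rfl⟩, htop⟩
        exact ⟨(h𝒱 _ (e p.1).2).1.preimage (hX _), htop⟩)
      refine ⟨y, hyF, fun s hs k hk hsk => ?_⟩
      have hs' : ((s.subtype (· ∈ Iio j)).inf fun i => f i) = s.inf f := by
        conv_rhs => rw [← Finset.subtype_map_of_mem (p := (· ∈ Iio j)) hs, Finset.inf_map]
        rfl
      have := hy (g (⟨k, hk⟩, s.subtype (· ∈ Iio j)))
        ⟨⟨_, rfl⟩, by simpa only [g, mem_ofPred_eq, inf_top_eq, hs'] using hsk⟩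
      simpa only [g, mem_ofPred_eq, hs'] using this
    obtain ⟨x, hxF, hx⟩ := exists_finset_inf_mem (T := fun _ => F) (O := fun j => (e j).1)
      (fun j => (h𝒱 _ (e j).2).2) step
    obtain ⟨d, hd⟩ := hc.exists_isLUB hX {a | ∃ j, ∀ i, j ≤ i → a ≤ x i}
    obtain ⟨hdF, hdO⟩ := hc.liminf_mem hX hF hxF hx hd
    refine ⟨d, hdF, fun V hV => ?_⟩
    have := hdO (e.symm ⟨V, hV⟩)
    rwa [Equiv.apply_symm_apply, (h𝒱 V hV).1.isClosed.closure_eq] at this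

theorem IsCompletePoset.top_mem_of_isRegularGδ (hX : IsSemitopological X)
    (hc : IsCompletePoset X) {F : Set X} (hF : IsChainClosedLower F) (htop : ⊤ ∈ closure F)
    (hsep : ∀ x y : X, x ≠ y → ∃ S, IsRegularGδ S ∧ x ∈ S ∧ y ∉ S) : ⊤ ∈ F := by
  obtain ⟨d, hd, hd'⟩ := hc.exists_mem_of_isRegularGδ hX hF htop _ {V | IsRegularGδ V ∧ ⊤ ∈ V} rfl
    fun V hV => hV
  by_contra h
  obtain ⟨S, hS, htS, hdS⟩ := hsep ⊤ d fun h' => h (h' ▸ hd)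
  exact hdS (hd' S ⟨hS, htS⟩)

end RegularGδ

end TopSemilattice

namespace TopSemilattice

open Set Filter Topology

/-! ### Sequential spaces -/

theorem sequentialSpace_of_isClosed {X : Type*} [TopologicalSpace X] [SequentialSpace X]
    {A : Set X} (hA : IsClosed A) : SequentialSpace A := by
  refine ⟨fun B hB => ?_⟩
  have h : IsSeqClosed (Subtype.val '' B) := by
    intro u a hu hua
    choose w hwB hw using hu
    have ha : a ∈ A := hA.mem_of_tendsto hua (.of_forall fun n => hw n ▸ (w n).2)
    refine ⟨⟨a, ha⟩, hB hwB ?_, rfl⟩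
    rw [tendsto_subtype_rng]
    simpa only [hw] using hua
  have := h.isClosed.preimage (continuous_subtype_val (p := (· ∈ A)))
  rwa [preimage_image_eq _ Subtype.val_injective] at this

/-- In a sequential complete semitopological semilattice chains have countable cofinality. -/
theorem IsCompletePoset.exists_countable_cofinal {X : Type*} [SemilatticeInf X]
    [TopologicalSpace X] [T2Space X] [SequentialSpace X] (hX : IsSemitopological X)
    (hc : IsCompletePoset X) {E : Set X} (hE : IsChain (· ≤ ·) E) (hne : E.Nonempty) :
    ∃ C ⊆ E, C.Countable ∧ C.Nonempty ∧ ∀ e ∈ E, ∃ c ∈ C, e ≤ c := by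
  by_contra! h
  obtain ⟨-, s, hs, hlub⟩ := hc E hE hne
  -- Without a countable cofinal subset, any sequence below `E` is bounded by a single `e ∈ E`, so
  -- this set is sequentially closed. It then contains `sup E`, which makes `E` have a greatest
  -- element.
  have hD : IsSeqClosed {y | ∃ e ∈ E, y ≤ e} := by
    intro u a hu hua
    choose w hwE hw using hu
    obtain ⟨e, he, hew⟩ := h (range w) (range_subset_iff.2 hwE) (countable_range w)
      (range_nonempty w)
    refine ⟨e, he, (hX.isClosed_Iic e).mem_of_tendsto hua (.of_forall fun n => ?_)⟩
    exact (hw n).trans ((hE.total he (hwE n)).resolve_left (hew _ ⟨n, rfl⟩))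
  obtain ⟨e, he, hse⟩ := closure_minimal
    (show E ⊆ {y | ∃ e ∈ E, y ≤ e} from fun e he => ⟨e, he, le_rfl⟩) hD.isClosed hs
  obtain ⟨e', he', hne⟩ := h {e} (singleton_subset_iff.2 he) (countable_singleton e)
    (singleton_nonempty e)
  exact hne e rfl ((hlub.1 he').trans hse)

/-- Refining a filter can only raise its lower limit `L`. For a filter where `L` can no longer rise,
every further refinement has the same `L`; refining towards each neighborhood of `⊤` places this
value in `F` and in the closures of all of them. -/
theorem IsCompletePoset.top_mem_of_tendsto {X : Type*} [SemilatticeInf X] [OrderTop X]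
    [TopologicalSpace X] [T2Space X] [SequentialSpace X] (hX : IsSemitopological X)
    (hc : IsCompletePoset X) {F : Set X} (hF : IsChainClosedLower F) {u : ℕ → X}
    (hu : ∀ n, u n ∈ F) (hlim : Tendsto u atTop (𝓝 ⊤)) : ⊤ ∈ F := by
  let P := {l : Filter X // l.NeBot ∧ l.IsCountablyGenerated ∧ F ∈ l ∧ l ≤ 𝓝 ⊤}
  choose L hL using fun l : P => hc.exists_isLUB hX {a | ∀ᶠ y in l.1, a ≤ y}
  have hanti : ∀ l l' : P, l.1 ≤ l'.1 → L l' ≤ L l := fun l l' h =>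
    (hL l').2 fun a ha => (hL l).1 (h ha)
  have refine_mem : ∀ l : P, ∀ O : Set X, IsOpen O → ⊤ ∈ O →
      ∃ l' : P, l'.1 ≤ l.1 ∧ L l' ∈ F ∧ L l' ∈ closure O := by
    rintro ⟨l, hne, hcg, hFl, hl⟩ O hO htop
    obtain ⟨B, hB⟩ := l.exists_antitone_basis
    obtain ⟨x, hxB, hx⟩ := exists_seq_finset_inf_mem hX hl (T := fun n => B n ∩ F)
      (fun n => inter_mem (hB.mem n) hFl) (fun _ : ℕ => hO) fun _ => htop
    have hxl : Tendsto x atTop l := hB.tendsto fun n => (hxB n).1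
    let l' : P := ⟨map x atTop, inferInstance, inferInstance,
      mem_map.2 (univ_mem' fun n => (hxB n).2), hxl.trans hl⟩
    have hlub := hL l'
    simp only [l', eventually_map, eventually_atTop] at hlub
    obtain ⟨h1, h2⟩ := hc.liminf_mem hX hF (fun n => (hxB n).2) hx hlub
    exact ⟨l', hxl, h1, h2 0⟩
  let u' : P := ⟨map u atTop, inferInstance, inferInstance, mem_map.2 (univ_mem' hu), hlim⟩
  -- Requiring `L` to grow strictly lets countable cofinality of the chain of values pass to the
  -- chain of filters, so that its infimum stays countably generated.
  let r : P → P → Prop := fun l l' => l = l' ∨ l'.1 ≤ l.1 ∧ L l < L l'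
  obtain ⟨l, hl⟩ : ∃ l, ∀ l', r l l' → r l' l := by
    have : Nonempty P := ⟨u'⟩
    refine exists_maximal_of_nonempty_chains_bounded (fun c hch hcne => ?_) ?_
    · have hE : IsChain (· ≤ ·) (L '' c) := by
        rintro _ ⟨l, hl, rfl⟩ _ ⟨l', hl', rfl⟩ hne
        rcases hch hl hl' fun h => hne (h ▸ rfl) with (h | h) | (h | h)
        exacts [absurd (h ▸ rfl) hne, .inl h.2.le, absurd (h ▸ rfl) hne, .inr h.2.le]
      obtain ⟨C, hCE, hCc, hCne, hC⟩ := hc.exists_countable_cofinal hX hE (hcne.image L)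
      choose! φ hφc hφ using show ∀ e ∈ C, ∃ l ∈ c, L l = e from hCE
      have hle : ∀ l ∈ c, ∃ e ∈ C, (φ e).1 ≤ l.1 ∧ L l ≤ L (φ e) := by
        intro l hl
        obtain ⟨e, he, hle⟩ := hC _ ⟨l, hl, rfl⟩
        refine ⟨e, he, ?_, (hφ e he).symm ▸ hle⟩
        rcases eq_or_ne l (φ e) with h | hne
        · rw [← h]
        · rcases hch hl (hφc e he) hne with (h | h) | (h | h)
          · exact absurd h hne
          · exact h.1
          · exact absurd h.symm hne
          · exact absurd (h.2.trans_le hle) (by rw [hφ e he]; exact lt_irrefl _)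
      have : Countable C := hCc
      have : Nonempty C := hCne.to_subtype
      have hdir : Directed (· ≥ ·) fun e : C => (φ e).1 := by
        intro e e'
        rcases eq_or_ne (φ e) (φ e') with h | hne
        · exact ⟨e, le_rfl, (congrArg Subtype.val h).le⟩
        · rcases hch (hφc e e.2) (hφc e' e'.2) hne with (h | h) | (h | h)
          exacts [absurd h hne, ⟨e', h.1, le_rfl⟩, absurd h.symm hne, ⟨e, le_rfl, h.1⟩]
      obtain ⟨e₀⟩ := ‹Nonempty C›
      let b : P := ⟨⨅ e : C, (φ e).1, iInf_neBot_of_directed' hdir fun e => (φ e).2.1,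
        @iInf.isCountablyGenerated _ _ _ _ fun e : C => (φ e).2.2.1,
        iInf_le (fun e : C => (φ e).1) e₀ (φ e₀).2.2.2.1,
        (iInf_le _ e₀).trans (φ e₀).2.2.2.2⟩
      have hb : ∀ l ∈ c, b.1 ≤ l.1 := fun l hl => by
        obtain ⟨e, he, h, -⟩ := hle l hl
        exact (iInf_le (fun e : C => (φ e).1) ⟨e, he⟩).trans h
      -- If some `L l₀` is not strictly below `L b`, no member of the chain exceeds `l₀`, so `l₀`
      -- itself is the bound.
      by_cases hlt : ∀ l ∈ c, L l < L b
      · exact ⟨b, fun l hl => .inr ⟨hb l hl, hlt l hl⟩⟩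
      · push Not at hlt
        obtain ⟨l₀, hl₀, h₀⟩ := hlt
        refine ⟨l₀, fun l hl => ?_⟩
        rcases eq_or_ne l l₀ with h | hne
        · exact .inl h
        · rcases hch hl hl₀ hne with h | (h | h)
          · exact h
          · exact .inl h.symm
          · exact absurd (h.2.trans_le (hanti _ _ (hb l hl))) h₀
    · rintro a b c (rfl | h) (rfl | h')
      exacts [.inl rfl, .inr h', .inr h, .inr ⟨h'.1.trans h.1, h.2.trans h'.2⟩]
  have hmax : ∀ l' : P, l'.1 ≤ l.1 → L l' = L l := by
    intro l' h
    rcases (hanti _ _ h).eq_or_lt with h' | h'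
    · exact h'.symm
    · rcases hl l' (.inr ⟨h, h'⟩) with h'' | h''
      · rw [h'']
      · exact absurd h''.2 h'.not_gt
  obtain ⟨l₁, hl₁, hmem, -⟩ := refine_mem l univ isOpen_univ trivial
  rw [hmax l₁ hl₁] at hmem
  by_contra hF'
  obtain ⟨O, O', hO, hO', htop, hLO, hdisj⟩ :=
    t2_separation (show (⊤ : X) ≠ L l from fun h => hF' (h ▸ hmem))
  obtain ⟨l₂, hl₂, -, hcl⟩ := refine_mem l O hO htop
  rw [hmax l₂ hl₂] at hcl
  exact (hdisj.closure_left hO').le_bot ⟨hcl, hLO⟩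

/-! ### Reduction to the top element of a principal ideal -/

section Iic

theorem isLUB_subtype_Iic {X : Type*} [SemilatticeInf X] {x : X} {C : Set (Set.Iic x)} {b : Set.Iic x} :
    IsLUB (Subtype.val '' C) b.1 ↔ IsLUB C b := by
  refine ⟨fun h => ⟨fun y hy => h.1 ⟨y, hy, rfl⟩, fun z hz => h.2 ?_⟩,
    fun h => ⟨?_, fun z hz => ?_⟩⟩
  · rintro _ ⟨y, hy, rfl⟩
    exact hz hy
  · rintro _ ⟨y, hy, rfl⟩
    exact h.1 hy
  · have : b ≤ ⟨x ⊓ z, inf_le_left⟩ := h.2 fun y hy => le_inf y.2 (hz ⟨y, hy, rfl⟩)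
    exact le_trans this inf_le_right

variable {X : Type*} [SemilatticeInf X] [TopologicalSpace X]

theorem IsSemitopological.Iic (hX : IsSemitopological X) (x : X) :
    IsSemitopological (Set.Iic x) := fun a =>
  ((hX a.1).comp continuous_subtype_val).subtype_mk _

theorem continuousInf_Iic [ContinuousInf X] (x : X) : ContinuousInf (Set.Iic x) :=
  ⟨((continuous_subtype_val.comp continuous_fst).inf
    (continuous_subtype_val.comp continuous_snd)).subtype_mk _⟩

theorem IsCompletePoset.Iic (hc : IsCompletePoset X) (x : X) : IsCompletePoset (Set.Iic x) := by
  intro C hC hne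
  have hC' : IsChain (· ≤ ·) (Subtype.val '' C) := by
    rintro _ ⟨y, hy, rfl⟩ _ ⟨z, hz, rfl⟩ -
    exact hC.total hy hz
  obtain ⟨⟨a, ha, hglb⟩, b, hb, hlub⟩ := hc _ hC' (hne.image _)
  obtain ⟨c, hcC⟩ := hne
  have hax : a ≤ x := (hglb.1 ⟨c, hcC, rfl⟩).trans c.2
  have hbx : b ≤ x := hlub.2 (by rintro _ ⟨y, -, rfl⟩; exact y.2)
  refine ⟨⟨⟨a, hax⟩, closure_subtype.2 ha, fun y hy => hglb.1 ⟨y, hy, rfl⟩,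
    fun z hz => hglb.2 ?_⟩, ⟨b, hbx⟩, closure_subtype.2 hb, isLUB_subtype_Iic.1 hlub⟩
  rintro _ ⟨y, hy, rfl⟩
  exact hz hy

theorem IsChainClosedLower.Iic {X : Type*} [SemilatticeInf X] {F : Set X} (hF : IsChainClosedLower F) (x : X) :
    IsChainClosedLower (Subtype.val ⁻¹' F : Set (Set.Iic x)) where
  lower _ _ hab ha := hF.lower hab ha
  sup_mem C hCF hC hne b hb := hF.sup_mem (Subtype.val '' C) (image_subset_iff.2 hCF)
    (by rintro _ ⟨y, hy, rfl⟩ _ ⟨z, hz, rfl⟩ -; exact hC.total hy hz) (hne.image _) _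
    (isLUB_subtype_Iic.2 hb)

theorem IsVecT2Delta.subtype {X : Type u} [TopologicalSpace X] (hX : IsVecT2Delta.{u, v} X)
    (A : Set X) : IsVecT2Delta.{u, v} A := by
  obtain ⟨Y, hYtop, hY, f, hf, hinj⟩ := hX
  exact ⟨Y, hYtop, hY, fun a => f a, hf.comp continuous_subtype_val,
    hinj.comp Subtype.val_injective⟩

theorem IsFunctionallyHausdorff.subtype {X : Type*} [TopologicalSpace X]
    (hX : IsFunctionallyHausdorff X) (A : Set X) : IsFunctionallyHausdorff A := by
  intro x y hxy
  obtain ⟨f, hf, hne⟩ := hX x y (Subtype.val_injective.ne hxy)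
  exact ⟨fun a => f a, hf.comp continuous_subtype_val, hne⟩

theorem IsSemitopological.tendsto_Iic (hX : IsSemitopological X) (x : X) :
    Tendsto (fun y => (⟨x ⊓ y, inf_le_left⟩ : Set.Iic x)) (𝓝 x) (𝓝 ⊤) := by
  rw [tendsto_subtype_rng]
  have := (hX x).tendsto x
  rwa [inf_idem] at this

theorem IsSemitopological.top_mem_closure_Iic (hX : IsSemitopological X) {F : Set X}
    (hF : IsLowerSet F) {x : X} (hx : x ∈ closure F) :
    (⊤ : Set.Iic x) ∈ closure (Subtype.val ⁻¹' F) := by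
  rw [mem_closure_iff_frequently] at hx ⊢
  exact (hX.tendsto_Iic x).frequently (hx.mono fun y hy => hF inf_le_right hy)

theorem IsScottOpen.isChainClosedLower_compl {X : Type*} [PartialOrder X] {U : Set X}
    (hU : IsScottOpen U) : IsChainClosedLower Uᶜ where
  lower := hU.1.compl
  sup_mem C hCU hC hne b hb hbU := by
    obtain ⟨y, hyC, hyU⟩ := hU.2 C hne hC.directedOn b hb hbU
    exact hCU hyC hyU

theorem IsChainClosedLower.isClosed_of_top_mem_Iic (hX : IsSemitopological X) {F : Set X}
    (hF : IsChainClosedLower F)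
    (h : ∀ x : X, (⊤ : Set.Iic x) ∈ closure (Subtype.val ⁻¹' F) →
      (⊤ : Set.Iic x) ∈ (Subtype.val ⁻¹' F : Set (Set.Iic x))) : IsClosed F :=
  isClosed_of_closure_subset fun x hx => h x (hX.top_mem_closure_Iic hF.lower hx)

end Iic

end TopSemilattice

open TopSemilattice in
theorem theorem7p3 (X : Type u) [SemilatticeInf X] [TopologicalSpace X] [T2Space X]
    (hsemi : TopSemilattice.IsSemitopological X)
    (hcomplete : TopSemilattice.IsCompletePoset X)
    (h : ContinuousInf X ∨ SequentialSpace X ∨ TopSemilattice.IsVecT2Delta.{u, v} X ∨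
      TopSemilattice.IsFunctionallyHausdorff X)
    (U : Set X) (hU : TopSemilattice.IsScottOpen U) :
    IsOpen U := by
  rw [← isClosed_compl_iff]
  have hF := hU.isChainClosedLower_compl
  rcases h with h | h | h | h
  · refine hF.isClosed_of_top_mem_Iic hsemi fun x hx => ?_
    have := continuousInf_Iic x
    exact (hcomplete.Iic x).top_mem_of_continuousInf (hsemi.Iic x) (hF.Iic x) hx
  -- Here a sequence, not just a closure point, is needed: the argument starts from a countably
  -- generated filter containing `F`.
  · refine IsSeqClosed.isClosed fun u x hu hux => ?_
    have := sequentialSpace_of_isClosed (hsemi.isClosed_Iic x)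
    exact (hcomplete.Iic x).top_mem_of_tendsto (hsemi.Iic x) (hF.Iic x)
      (fun n => hF.lower inf_le_right (hu n)) ((hsemi.tendsto_Iic x).comp hux)
  · exact hF.isClosed_of_top_mem_Iic hsemi fun x hx =>
      (hcomplete.Iic x).top_mem_of_isRegularGδ (hsemi.Iic x) (hF.Iic x) hx
        fun _ _ => (h.subtype _).exists_isRegularGδ
  · exact hF.isClosed_of_top_mem_Iic hsemi fun x hx =>
      (hcomplete.Iic x).top_mem_of_isRegularGδ (hsemi.Iic x) (hF.Iic x) hx
        fun _ _ => (h.subtype _).exists_isRegularGδ
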